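/- **Setting.** Let $(\Omega,\mathcal F,\mathbb P)$ be a complete probability space, $(Z,\mathcal Z)$ a measurable space and $V$ a real separable Banach space with dual $V'$. *Point processes.* A point function is a map $\theta:D(\theta)\to Z$ with $D(\theta)\subseteq(0,\infty)$ countable; the set of point functions carries the $\sigma$-algebra generated by the sets $\{\theta:\#\{t\in D(\theta):(t,\theta(t))\in U\}=k\}$, $k\in\mathbb N_0$, $U\in\mathfrak B((0,\infty))\otimes\mathcal Z$. Let $\Theta$ be a finite point process, i.e. a measurable map from $\Omega$ to the set of point functions such that its counting measure $N_\Theta(U,\omega)=\#\{t\in D(\Theta(\omega)):(t,\Theta(\omega)(t))\in U\}$ satisfies $\mathbb E\,N_\Theta((0,t]\times Z)<\infty$ for all $t>0$. Put $\alpha_0=0$ and let $\alpha_1<\alpha_2<\dots$ be the elements of $D(\Theta)$ in increasing order (almost surely $D(\Theta)\cap(0,t]$ is finite for all $t>0$), with $\alpha_m=\infty$ if $D(\Theta)$ has fewer than $m$ elements. *Operators.* Let $\mathcal A:V\to 2^V$ be a multi-valued operator with domain $D(\mathcal A)=\{v:\mathcal Av\ne\emptyset\}$ which is densely defined ($\overline{D(\mathcal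 A)}=V$) and m-accretive, i.e. $\|v_1-v_2\|\le\|v_1-v_2+\alpha(\hat v_1-\hat v_2)\|$ for all $\alpha>0$, $\hat v_i\in\mathcal Av_i$, and $R(\mathrm{Id}+\alpha\mathcal A)=V$ for all $\alpha>0$. For $v\in V$ let $T_{\mathcal A}(\cdot)v:[0,\infty)\to V$ be the unique mild solution of $0\in u'+\mathcal Au$, $u(0)=v$ (the uniform limit on compact time intervals of solutions of implicit time discretizations with vanishing errors). Assume that $\mathcal A$ is domain invariant, i.e. $T_{\mathcal A}(t)v\in D(\mathcal A)$ for all $t>0$, $v\in V$, and that $T_{\mathcal A}$ admits an infinitesimal generator $\mathcal A^\circ:V\to V$, i.e. $-\lim_{h\searrow0}\frac{T_{\mathcal A}(h)v-v}{h}=\mathcal A^\circ v\in\mathcal Av$ for $v\in D(\mathcal A)$ and $\mathcal A^\circ v=0$ for $v\notin D(\mathcal A)$. *Solutions.* Let $V^*\subseteq V'$ be a set that separates points, and let $x:\Omega\to V$ and $\eta:(0,\infty)\times Z\times\Omega\to V$ be measurable. A jointly measurable process $X:[0,\infty)\times\Omega\to V$ is a *strong solution* of $$\eta(t,z)\,N_\Theta(dt\otimes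 z)\in dX(t)+\mathcal AX(t)\,dt\tag{ACPRM}$$ with data $\{x,\eta,V^*\}$ if almost surely: (i) $X(0)=x$; (ii) $t\mapsto X(t)$ is càdlàg; (iii) $X(t)\in D(\mathcal A)$ for all $t\in(0,\infty)\setminus\{\alpha_m:m\ge1\}$; (iv) for all $m\ge0$ and $[a,b]\subseteq(\alpha_m,\alpha_{m+1})$, $X|_{[a,b]}$ is absolutely continuous and differentiable a.e.; (v) $\langle\Psi,\mathcal A^\circ X(\cdot)\rangle\in L^1(0,t)$ for all $t>0$, $\Psi\in V^*$; (vi) for all $t>0$, $\Psi\in V^*$, $$\langle\Psi,X(t)-x\rangle+\int_0^t\langle\Psi,\mathcal A^\circ X(\tau)\rangle\,d\tau=\int_{(0,t]\times Z}\langle\Psi,\eta(\tau,z)\rangle\,N_\Theta(d\tau\otimes z).$$ A jointly measurable process $Y$ is a *mild solution* with data $\{x,\eta,V^*\}$ if it satisfies (i)–(iv) almost surely and there are measurable $x_m$, $\eta_m$ and strong solutions $X_m$ with data $\{x_m,\eta_m,V^*\}$, $m\in\mathbb N$, such that almost surely, for all $t>0$, $\sup_{\tau\in[0,t]}\|X_m(\tau)-Y(\tau)\|\to0$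 and $\int_{(0,t]\times Z}\|\eta_m-\eta\|\,dN_\Theta\to0$ as $m\to\infty$. **Theorem.** Let $V^*\subseteq V'$ be a set that separates points, let $\eta_1,\eta_2:(0,\infty)\times Z\times\Omega\to V$ and $x_1,x_2:\Omega\to V$ be measurable, and let $X_i$ be a mild solution of (ACPRM) with data $\{x_i,\eta_i,V^*\}$, $i=1,2$. Then almost surely, for all $t\ge0$, the integral below exists and is finite, and $$\|X_1(t)-X_2(t)\|\le\|x_1-x_2\|+\int_{(0,t]\times Z}\|\eta_1(\tau,z)-\eta_2(\tau,z)\|\,N_\Theta(d\tau\otimes z).$$ -/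

import Mathlib

open MeasureTheory Set Filter
open scoped NNReal ENNReal Topology

namespace ACPRM

/-! ### Point functions, point processes and their counting measures -/

/-- The time set `(0,∞)`, with its Borel σ-algebra (as a subspace of `[0,∞)`). -/
abbrev PosTime : Type := Set.Ioi (0 : ℝ≥0)

/-- A point function: a map from a countable set `D(θ) ⊆ (0,∞)` to `Z`. -/
structure PointFunction (Z : Type*) where
  domain : Set PosTime
  countable_domain : domain.Countable
  toFun : domain → Z

section PointProcess

variable {Z : Type*} [MeasurableSpace Z]

/-- The number of `t ∈ D(θ)` with `(t, θ(t)) ∈ U`. -/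
noncomputable def PointFunction.numPoints (θ : PointFunction Z) (U : Set (PosTime × Z)) : ℕ∞ :=
  Set.encard {t : θ.domain | ((t : PosTime), θ.toFun t) ∈ U}

/-- The σ-algebra on the set of point functions, generated by the sets
`{θ | #{t ∈ D(θ) : (t, θ(t)) ∈ U} = k}` with `U` measurable and `k ∈ ℕ`. -/
instance instMeasurableSpacePointFunction : MeasurableSpace (PointFunction Z) :=
  MeasurableSpace.generateFrom
    {S | ∃ U : Set (PosTime × Z), MeasurableSet U ∧ ∃ k : ℕ, S = {θ | θ.numPoints U = (k : ℕ∞)}}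

/-- The counting measure of a point function, a measure on `(0,∞) × Z`. -/
noncomputable def PointFunction.countingMeasure (θ : PointFunction Z) : Measure (PosTime × Z) :=
  Measure.sum fun t : θ.domain => Measure.dirac ((t : PosTime), θ.toFun t)

/-- `countingMeasure` counts the points `t ∈ D(θ)` with `(t, θ(t)) ∈ U`. -/
theorem PointFunction.countingMeasure_apply (θ : PointFunction Z) {U : Set (PosTime × Z)}
    (hU : MeasurableSet U) : θ.countingMeasure U = (θ.numPoints U : ℝ≥0∞) := by
  rw [PointFunction.countingMeasure, Measure.sum_apply _ hU, PointFunction.numPoints,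
    ← ENNReal.tsum_set_one, tsum_subtype _ (fun _ => (1 : ℝ≥0∞))]
  refine tsum_congr fun t => ?_
  rw [Measure.dirac_apply' _ hU]
  by_cases h : ((t : PosTime), θ.toFun t) ∈ U
  · rw [Set.indicator_of_mem h, Set.indicator_of_mem (by exact h)]
    rfl
  · rw [Set.indicator_of_notMem h, Set.indicator_of_notMem (by exact h)]

/-- The set `(0,t] × Z`. -/
def strip (Z : Type*) (t : ℝ≥0) : Set (PosTime × Z) :=
  {p | (p.1 : ℝ≥0) ≤ t}

/-- The hitting times `α₀ = 0 < α₁ < α₂ < …` of a point function: `α₍ₘ₊₁₎` is the first element of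
`D(θ)` after `αₘ`, and `∞` if there is none. -/
noncomputable def PointFunction.hittingTime (θ : PointFunction Z) : ℕ → ℝ≥0∞
  | 0 => 0
  | m + 1 => sInf {s : ℝ≥0∞ | (∃ t ∈ θ.domain, s = ((t : ℝ≥0) : ℝ≥0∞)) ∧ θ.hittingTime m < s}

/-- A finite point process on the probability space `(Ω, P)`: a measurable map into the set of point
functions such that the expectation of `N((0,t] × Z)` is finite for all `t > 0`. -/
structure IsFinitePointProcess {Ω : Type*} [MeasurableSpace Ω] (P : Measure Ω)
    (Θ : Ω → PointFunction Z) : Prop where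
  measurable : Measurable Θ
  finite : ∀ t : ℝ≥0, 0 < t → ∫⁻ ω, (Θ ω).countingMeasure (strip Z t) ∂P < ∞

end PointProcess

/-! ### Multi-valued operators and nonlinear semigroups -/

section Operator

variable {V : Type*} [NormedAddCommGroup V] [NormedSpace ℝ V]

/-- The domain `D(A)` of a multi-valued operator. -/
def opDomain (A : V → Set V) : Set V := {v | (A v).Nonempty}

def IsAccretive (A : V → Set V) : Prop :=
  ∀ v₁ v₂ : V, ∀ y₁ ∈ A v₁, ∀ y₂ ∈ A v₂, ∀ α : ℝ, 0 < α →
    ‖v₁ - v₂‖ ≤ ‖v₁ - v₂ + α • (y₁ - y₂)‖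

structure IsMAccretive (A : V → Set V) : Prop where
  accretive : IsAccretive A
  range_eq : ∀ α : ℝ, 0 < α → ∀ w : V, ∃ v : V, ∃ y ∈ A v, v + α • y = w

def IsDenselyDefined (A : V → Set V) : Prop := Dense (opDomain A)

/-- `u : [0,∞) → V` is a mild solution of `0 ∈ u' + A u`, `u(0) = v`: it is continuous, `u(0) = v`,
and on every interval `[0,T]` and for every `ε > 0` it is `ε`-close to a solution
`w₀, …, w_N` of an implicit time discretization
`(w₍ᵢ₊₁₎ - wᵢ) / (t₍ᵢ₊₁₎ - tᵢ) + A w₍ᵢ₊₁₎ ∋ fᵢ` along `0 = t₀ < ⋯ < t_N ≤ T` with mesh at most `ε`,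
`T - t_N ≤ ε` and total error `∑ᵢ (t₍ᵢ₊₁₎ - tᵢ) ‖fᵢ‖ ≤ ε`. -/
def IsCauchyMildSolution (A : V → Set V) (v : V) (u : ℝ≥0 → V) : Prop :=
  Continuous u ∧ u 0 = v ∧
    ∀ T : ℝ≥0, 0 < T → ∀ ε : ℝ, 0 < ε →
      ∃ (N : ℕ) (t : ℕ → ℝ≥0) (f w : ℕ → V),
        t 0 = 0 ∧
        (∀ i < N, t i < t (i + 1) ∧ (t (i + 1) : ℝ) - t i ≤ ε) ∧
        t N ≤ T ∧ (T : ℝ) - t N ≤ ε ∧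
        ∑ i ∈ Finset.range N, ((t (i + 1) : ℝ) - t i) * ‖f i‖ ≤ ε ∧
        (∀ i < N, ∃ y ∈ A (w (i + 1)),
          ((t (i + 1) : ℝ) - t i)⁻¹ • (w (i + 1) - w i) + y = f i) ∧
        ‖u 0 - w 0‖ ≤ ε ∧
        ∀ i < N, ∀ s : ℝ≥0, t i < s → s ≤ t (i + 1) → ‖u s - w (i + 1)‖ ≤ ε

open Classical in
/-- The semigroup `T_A`: `semigroup A t v` is the value at time `t` of the mild solution of
`0 ∈ u' + A u`, `u(0) = v`. This solution exists and is unique when `A` is m-accretive and densely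
defined; the default value is used only if there is none. -/
noncomputable def semigroup (A : V → Set V) (t : ℝ≥0) (v : V) : V :=
  if h : ∃ u : ℝ≥0 → V, IsCauchyMildSolution A v u then h.choose t else v

/-- `T_A` is domain invariant: it maps `V` to `D(A)` at all positive times. -/
def IsDomainInvariant (A : V → Set V) : Prop :=
  ∀ t : ℝ≥0, 0 < t → ∀ v : V, semigroup A t v ∈ opDomain A

/-- `A₀ : V → V` is the infinitesimal generator of `T_A`. -/
structure IsInfinitesimalGenerator (A : V → Set V) (A₀ : V → V) : Prop where
  tendsto : ∀ v ∈ opDomain A,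
    Tendsto (fun h : ℝ≥0 => -((h : ℝ)⁻¹ • (semigroup A h v - v))) (𝓝[>] 0) (𝓝 (A₀ v))
  mem : ∀ v ∈ opDomain A, A₀ v ∈ A v
  eq_zero : ∀ v ∉ opDomain A, A₀ v = 0

/-- A set of continuous linear functionals separates points. -/
def SeparatesPoints (Vstar : Set (V →L[ℝ] ℝ)) : Prop :=
  ∀ v : V, (∀ Ψ ∈ Vstar, Ψ v = 0) → v = 0

/-- Membership of (the restriction to `[a,b]` of) `f` in `W^{1,1}([a,b];V)`: absolutely continuous
on `[a,b]` and differentiable almost everywhere there. -/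
def IsW11On (f : ℝ → V) (a b : ℝ) : Prop :=
  AbsolutelyContinuousOnInterval f a b ∧
    ∀ᵐ s ∂(volume.restrict (Set.Icc a b)), DifferentiableAt ℝ f s

/-- Right-continuous with left limits on `[0,∞)`. -/
def IsCadlag (f : ℝ≥0 → V) : Prop :=
  ∀ t : ℝ≥0, ContinuousWithinAt f (Set.Ici t) t ∧ ∃ l : V, Tendsto f (𝓝[<] t) (𝓝 l)

end Operator

/-! ### Strong and mild solutions of `η(t,z) N_Θ(dt ⊗ z) ∈ dX(t) + A X(t) dt` -/

section Solutions

variable {V : Type*} [NormedAddCommGroup V] [NormedSpace ℝ V] {Z : Type*} [MeasurableSpace Z]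

/-- The conditions on a path `X : [0,∞) → V` shared by strong and mild solutions; here `x₀` is the
initial value and `θ` the realization of the point process. -/
structure IsRegularPath (A : V → Set V) (θ : PointFunction Z) (x₀ : V) (X : ℝ≥0 → V) : Prop where
  initial : X 0 = x₀
  cadlag : IsCadlag X
  mem_domain : ∀ t : ℝ≥0, 0 < t → (∀ m : ℕ, (t : ℝ≥0∞) ≠ θ.hittingTime (m + 1)) → X t ∈ opDomain A
  regular : ∀ m : ℕ, ∀ a b : ℝ≥0, a ≤ b → θ.hittingTime m < a → (b : ℝ≥0∞) < θ.hittingTime (m + 1) →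
    IsW11On (fun s : ℝ => X s.toNNReal) a b

/-- The integrability and integral identity that a path of a strong solution has to fulfill, where
`ξ` is the realization of the drift. -/
structure IsWeakIntegralSolution (A₀ : V → V) (Vstar : Set (V →L[ℝ] ℝ)) (θ : PointFunction Z)
    (x₀ : V) (ξ : PosTime × Z → V) (X : ℝ≥0 → V) : Prop where
  integrable : ∀ t : ℝ≥0, 0 < t → ∀ Ψ ∈ Vstar,
    IntegrableOn (fun τ : ℝ => Ψ (A₀ (X τ.toNNReal))) (Set.Ioo 0 (t : ℝ)) volume
  identity : ∀ t : ℝ≥0, 0 < t → ∀ Ψ ∈ Vstar,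
    Ψ (X t - x₀) + ∫ τ in (0 : ℝ)..t, Ψ (A₀ (X τ.toNNReal)) =
      ∫ p in strip Z t, Ψ (ξ p) ∂θ.countingMeasure

variable [MeasurableSpace V] {Ω : Type*} [MeasurableSpace Ω]

/-- `X` is a strong solution of (ACPRM)`{x, η, Vstar}`. -/
structure IsStrongSolution (P : Measure Ω) (Θ : Ω → PointFunction Z) (A : V → Set V) (A₀ : V → V)
    (Vstar : Set (V →L[ℝ] ℝ)) (x : Ω → V) (η : PosTime × Z × Ω → V) (X : ℝ≥0 × Ω → V) : Prop where
  measurable : Measurable X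
  regular : ∀ᵐ ω ∂P, IsRegularPath A (Θ ω) (x ω) (fun t => X (t, ω))
  solves : ∀ᵐ ω ∂P,
    IsWeakIntegralSolution A₀ Vstar (Θ ω) (x ω) (fun p => η (p.1, p.2, ω)) (fun t => X (t, ω))

/-- `Y` is a mild solution of (ACPRM)`{x, η, Vstar}`: a process with regular paths that is, almost
surely locally uniformly in time, the limit of strong solutions with data `(xₘ, ηₘ)`, where `ηₘ`
converges to `η` in the integral against the counting measure. -/
structure IsMildSolution (P : Measure Ω) (Θ : Ω → PointFunction Z) (A : V → Set V) (A₀ : V → V)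
    (Vstar : Set (V →L[ℝ] ℝ)) (x : Ω → V) (η : PosTime × Z × Ω → V) (Y : ℝ≥0 × Ω → V) : Prop where
  measurable : Measurable Y
  regular : ∀ᵐ ω ∂P, IsRegularPath A (Θ ω) (x ω) (fun t => Y (t, ω))
  approx : ∃ (xs : ℕ → Ω → V) (ηs : ℕ → PosTime × Z × Ω → V) (Xs : ℕ → ℝ≥0 × Ω → V),
    (∀ m, Measurable (xs m)) ∧ (∀ m, Measurable (ηs m)) ∧
    (∀ m, IsStrongSolution P Θ A A₀ Vstar (xs m) (ηs m) (Xs m)) ∧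
    (∀ᵐ ω ∂P, ∀ t : ℝ≥0, 0 < t →
      Tendsto (fun m => ⨆ τ ∈ Set.Iic t, ‖Xs m (τ, ω) - Y (τ, ω)‖ₑ) atTop (𝓝 0)) ∧
    (∀ᵐ ω ∂P, ∀ t : ℝ≥0, 0 < t →
      Tendsto (fun m => ∫ p in strip Z t, ‖ηs m (p.1, p.2, ω) - η (p.1, p.2, ω)‖
        ∂(Θ ω).countingMeasure) atTop (𝓝 0))

end Solutions

end ACPRM

/-! Almost surely the point process has finitely many points up to each time, so for fixed ω every
integral against the counting measure is a finite sum of values at points. The estimate is therefore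
pathwise.

For strong solutions, testing the integral identity against a countable separating set gives `X' =
-A₀ X` almost everywhere between jumps (`IsWeakIntegralSolution.ae_hasDerivAt`). Since `A₀ v ∈ A v`,
accretivity makes the derivative of the distance of two solutions nonpositive (`deriv_norm_nonpos`),
and absolute continuity makes the distance nonincreasing. At a point of the process each path jumps
by its drift value there (`IsWeakIntegralSolution.eq_add_of_tendsto`), which increases the distance
by at most the norm of the difference of the drifts. Induction on the number of points yields
`norm_sub_le_add_sum`.

For mild solutions both sides pass to the limit: the paths converge at each time, and the finitely
many drift values converge one by one. -/

namespace ACPRM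

/-! ### Locally finite point functions -/

section PointFunctions

variable {Z : Type*}

/-- A point function with finitely many points in every bounded time interval. -/
def PointFunction.IsLocallyFinite (θ : PointFunction Z) : Prop :=
  ∀ t : ℝ≥0, {i : θ.domain | i.1.1 ≤ t}.Finite

/-- The points of a locally finite point function up to time `t`. -/
noncomputable def PointFunction.IsLocallyFinite.points {θ : PointFunction Z}
    (h : θ.IsLocallyFinite) (t : ℝ≥0) : Finset θ.domain :=
  (h t).toFinset

variable {θ : PointFunction Z}

@[simp]
theorem PointFunction.IsLocallyFinite.mem_points (h : θ.IsLocallyFinite) {t : ℝ≥0}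
    {i : θ.domain} : i ∈ h.points t ↔ i.1.1 ≤ t := by
  simp [PointFunction.IsLocallyFinite.points]

/-- Local finiteness turns the infimum into a minimum: only finitely many candidates precede a given
one. -/
theorem PointFunction.IsLocallyFinite.hittingTime_succ (h : θ.IsLocallyFinite) (m : ℕ) :
    θ.hittingTime (m + 1) = ⊤ ∨
      ∃ i : θ.domain, θ.hittingTime (m + 1) = (i.1.1 : ℝ≥0∞) ∧ θ.hittingTime m < i.1.1 := by
  rw [PointFunction.hittingTime]
  by_cases hne : ∃ j : θ.domain, θ.hittingTime m < (j.1.1 : ℝ≥0∞)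
  · right
    obtain ⟨j, hj⟩ := hne
    have hfin : {i : θ.domain | i.1.1 ≤ j.1.1 ∧ θ.hittingTime m < (i.1.1 : ℝ≥0∞)}.Finite :=
      (h j.1.1).subset fun i hi => hi.1
    obtain ⟨i, ⟨hij, hi⟩, hmin⟩ :=
      Set.exists_min_image _ (fun i : θ.domain => i.1.1) hfin ⟨j, le_rfl, hj⟩
    refine ⟨i, le_antisymm (sInf_le ⟨⟨i.1, i.2, rfl⟩, hi⟩) (le_sInf ?_), hi⟩
    rintro s ⟨⟨t, ht, rfl⟩, hs⟩
    rcases le_total t.1 j.1.1 with htj | htj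
    · exact_mod_cast hmin ⟨t, ht⟩ ⟨htj, hs⟩
    · exact_mod_cast hij.trans htj
  · left
    rw [sInf_eq_top]
    rintro s ⟨⟨t, ht, rfl⟩, hs⟩
    exact absurd ⟨⟨t, ht⟩, hs⟩ hne

/-- Times that are not in the domain are not hitting times. -/
theorem PointFunction.IsLocallyFinite.ne_hittingTime (h : θ.IsLocallyFinite) {t : ℝ≥0}
    (ht : ∀ i : θ.domain, i.1.1 ≠ t) (m : ℕ) : (t : ℝ≥0∞) ≠ θ.hittingTime (m + 1) := by
  rcases h.hittingTime_succ m with h' | ⟨i, hi, -⟩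
  · simp [h']
  · rw [hi]
    exact_mod_cast (ht i).symm

/-- An interval without points lies strictly between two consecutive hitting times. -/
theorem PointFunction.IsLocallyFinite.exists_hittingTime_between (h : θ.IsLocallyFinite)
    {a b : ℝ≥0} (ha : 0 < a) (hab : ∀ i : θ.domain, a ≤ i.1.1 → b < i.1.1) :
    ∃ m, θ.hittingTime m < a ∧ (b : ℝ≥0∞) < θ.hittingTime (m + 1) := by
  -- Otherwise, by induction, every hitting time stays below `a`, which produces infinitely many
  -- distinct points before `a`.
  by_contra! hcon
  have hlt : ∀ m, θ.hittingTime m < a := by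
    intro m
    induction m with
    | zero => simpa [PointFunction.hittingTime] using ha
    | succ m ih =>
      have hb := hcon m ih
      rcases h.hittingTime_succ m with h' | ⟨i, hi, -⟩
      · simp [h'] at hb
      · rw [hi] at hb ⊢
        by_contra! hai
        exact absurd (hab i (by exact_mod_cast hai)) (not_lt.2 (by exact_mod_cast hb))
  have hex : ∀ m, ∃ i : θ.domain, θ.hittingTime (m + 1) = (i.1.1 : ℝ≥0∞) ∧
      θ.hittingTime m < i.1.1 := fun m =>
    (h.hittingTime_succ m).resolve_left ((hlt (m + 1)).trans ENNReal.coe_lt_top).ne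
  have hmono : StrictMono θ.hittingTime := strictMono_nat_of_lt_succ fun m => by
    obtain ⟨i, hi, hlt'⟩ := hex m
    rwa [hi]
  choose i hi _ using hex
  refine Set.infinite_of_injective_forall_mem (f := i) (fun m n hmn => ?_) (fun m => ?_) (h a)
  · have := hmono.injective ((hi m).trans ((congrArg (fun j : θ.domain => (j.1.1 : ℝ≥0∞)) hmn).trans (hi n).symm))
    omega
  · have := hlt (m + 1)
    rw [hi m] at this
    exact_mod_cast this.le

/-- To the left of a time there is an interval without points. -/
theorem PointFunction.IsLocallyFinite.eventually_left (h : θ.IsLocallyFinite) (a : ℝ≥0) :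
    ∀ᶠ s in 𝓝[<] a, ∀ i : θ.domain, i.1.1 < a → i.1.1 ≤ s := by
  have : ∀ᶠ s in 𝓝[<] a, ∀ i ∈ h.points a, i.1.1 < a → i.1.1 ≤ s := by
    rw [Filter.eventually_all_finset]
    intro i _
    by_cases hi : i.1.1 < a
    · filter_upwards [mem_nhdsWithin_of_mem_nhds (Ioi_mem_nhds hi)] with s hs _
      exact hs.le
    · exact Filter.Eventually.of_forall fun s h' => absurd h' hi
  filter_upwards [this] with s hs i hi
  exact hs i (by simpa using hi.le) hi

/-- Stepping back from `i` to a time after all earlier points loses exactly one point, since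
distinct elements of the domain are distinct times. -/
theorem PointFunction.IsLocallyFinite.points_eq_erase [DecidableEq θ.domain]
    (h : θ.IsLocallyFinite) {s : ℝ≥0} {i : θ.domain}
    (hs : ∀ j : θ.domain, j.1.1 < i.1.1 → j.1.1 ≤ s) (hsi : s < i.1.1) :
    h.points s = (h.points i.1.1).erase i := by
  ext j
  rw [Finset.mem_erase, h.mem_points, h.mem_points]
  refine ⟨fun hj => ⟨?_, hj.trans hsi.le⟩, fun hj => hs j (lt_of_le_of_ne hj.2 fun he => hj.1 ?_)⟩
  · rintro rfl
    exact absurd hj (not_le.2 hsi)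
  · exact Subtype.ext (Subtype.ext he)

variable [MeasurableSpace Z]

theorem measurableSet_strip (t : ℝ≥0) : MeasurableSet (strip Z t) :=
  measurableSet_le (measurable_subtype_coe.comp measurable_fst) measurable_const

theorem PointFunction.IsLocallyFinite.restrict_strip (h : θ.IsLocallyFinite) (t : ℝ≥0) :
    θ.countingMeasure.restrict (strip Z t) =
      ∑ i ∈ h.points t, Measure.dirac ((i : PosTime), θ.toFun i) := by
  ext U hU
  rw [Measure.restrict_apply hU, PointFunction.countingMeasure,
    Measure.sum_apply _ (hU.inter (measurableSet_strip t)), Measure.finsetSum_apply,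
    tsum_eq_sum (s := h.points t)]
  · refine Finset.sum_congr rfl fun i hi => ?_
    rw [Measure.dirac_apply' _ hU, Measure.dirac_apply' _ (hU.inter (measurableSet_strip t))]
    have : ((i : PosTime), θ.toFun i) ∈ strip Z t := h.mem_points.1 hi
    by_cases hU' : ((i : PosTime), θ.toFun i) ∈ U <;> simp [Set.indicator, this, hU']
  · intro i hi
    rw [Measure.dirac_apply' _ (hU.inter (measurableSet_strip t))]
    have : ((i : PosTime), θ.toFun i) ∉ strip Z t := fun h' => hi (h.mem_points.2 h')
    simp [Set.indicator, this]

theorem PointFunction.IsLocallyFinite.integrableOn_strip (h : θ.IsLocallyFinite) (t : ℝ≥0)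
    {f : PosTime × Z → ℝ} (hf : Measurable f) :
    IntegrableOn f (strip Z t) θ.countingMeasure := by
  rw [IntegrableOn, h.restrict_strip, integrable_finsetSum_measure]
  exact fun i _ => integrable_dirac' hf.stronglyMeasurable (by simp)

theorem PointFunction.IsLocallyFinite.setIntegral_strip (h : θ.IsLocallyFinite) (t : ℝ≥0)
    {f : PosTime × Z → ℝ} (hf : Measurable f) :
    ∫ p in strip Z t, f p ∂θ.countingMeasure = ∑ i ∈ h.points t, f (i, θ.toFun i) := by
  rw [h.restrict_strip, integral_finsetSum_measure
    fun i _ => integrable_dirac' hf.stronglyMeasurable (by simp)]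
  exact Finset.sum_congr rfl fun i _ => integral_dirac' _ _ hf.stronglyMeasurable

theorem measurable_numPoints {U : Set (PosTime × Z)} (hU : MeasurableSet U) :
    Measurable fun θ : PointFunction Z => (θ.numPoints U : ℝ≥0∞) := by
  have hnat : ∀ k : ℕ, MeasurableSet {θ : PointFunction Z | θ.numPoints U = (k : ℕ∞)} :=
    fun k => MeasurableSpace.measurableSet_generateFrom ⟨U, hU, k, rfl⟩
  have : Measurable fun θ : PointFunction Z => θ.numPoints U := by
    refine measurable_to_countable' fun n => ?_
    induction n using ENat.recTopCoe with
    | top =>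
      -- The generating sets only fix finite counts; the infinite count is the complement of their
      -- countable union.
      have : (fun θ : PointFunction Z => θ.numPoints U) ⁻¹' {⊤} =
          (⋃ k : ℕ, {θ : PointFunction Z | θ.numPoints U = (k : ℕ∞)})ᶜ := by
        ext θ
        simp only [Set.mem_preimage, Set.mem_singleton_iff, Set.mem_compl_iff, Set.mem_iUnion,
          Set.mem_ofPred_eq, not_exists]
        exact ⟨fun h k => by simp [h], fun h => by
          by_contra h'
          obtain ⟨k, hk⟩ := ENat.ne_top_iff_exists.1 h'
          exact h k hk.symm⟩
      rw [this]
      exact (MeasurableSet.iUnion hnat).compl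
    | coe k => exact hnat k
  exact (measurable_of_countable (fun n : ℕ∞ => (n : ℝ≥0∞))).comp this

/-- Almost every realization of a finite point process is locally finite. -/
theorem IsFinitePointProcess.ae_isLocallyFinite {Ω : Type*} [MeasurableSpace Ω] {P : Measure Ω}
    {Θ : Ω → PointFunction Z} (hΘ : IsFinitePointProcess P Θ) :
    ∀ᵐ ω ∂P, (Θ ω).IsLocallyFinite := by
  -- Countably many times suffice for a common null set; the `+ 1` keeps them positive.
  have key : ∀ n : ℕ, ∀ᵐ ω ∂P, (Θ ω).countingMeasure (strip Z ((n : ℝ≥0) + 1)) < ∞ := by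
    intro n
    refine ae_lt_top ?_ (hΘ.finite _ (by positivity)).ne
    simp_rw [PointFunction.countingMeasure_apply _ (measurableSet_strip (Z := Z) _)]
    exact (measurable_numPoints (measurableSet_strip _)).comp hΘ.measurable
  filter_upwards [ae_all_iff.2 key] with ω hω t
  obtain ⟨n, hn⟩ := exists_nat_ge t
  have hfin := hω n
  rw [PointFunction.countingMeasure_apply _ (measurableSet_strip _), PointFunction.numPoints] at hfin
  have : {i : (Θ ω).domain | ((i : PosTime), (Θ ω).toFun i) ∈ strip Z ((n : ℝ≥0) + 1)}.Finite := by
    rw [← Set.encard_lt_top_iff]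
    exact_mod_cast hfin
  exact this.subset fun i hi => (le_trans hi hn).trans (by simp)

end PointFunctions

/-! ### Norms of absolutely continuous curves -/

section Curves

variable {V : Type*} [NormedAddCommGroup V]

theorem _root_.AbsolutelyContinuousOnInterval.norm {f : ℝ → V} {a b : ℝ}
    (hf : AbsolutelyContinuousOnInterval f a b) :
    AbsolutelyContinuousOnInterval (fun s => ‖f s‖) a b :=
  squeeze_zero (fun _ => Finset.sum_nonneg fun _ _ => dist_nonneg)
    (fun _ => Finset.sum_le_sum fun _ _ => (abs_norm_sub_norm_le _ _).trans_eq (dist_eq_norm _ _).symm) hf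

variable [NormedSpace ℝ V]

/-- The hypothesis compares `w s` with backward steps along `w'`, so left difference quotients are
used. For `x < s`, the backward step differs from `w x` by a remainder with derivative zero in norm;
adding that remainder to `‖w x‖` makes the left quotients nonpositive without changing their limit.
-/
theorem deriv_norm_nonpos {w : ℝ → V} {w' : V} {s : ℝ} (hw : HasDerivAt w w' s)
    (hle : ∀ h : ℝ, 0 < h → ‖w s‖ ≤ ‖w s - h • w'‖) : deriv (fun x => ‖w x‖) s ≤ 0 := by
  by_cases hd : DifferentiableAt ℝ (fun x => ‖w x‖) s
  swap
  · rw [deriv_zero_of_not_differentiableAt hd]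
  have hr : HasDerivAt (fun x => ‖w x - w s - (x - s) • w'‖) 0 s := by
    rw [hasDerivAt_iff_isLittleO] at hw ⊢
    simpa using hw.norm_left
  have hsum := (hd.hasDerivAt.add hr).tendsto_slope.mono_left
    (nhdsWithin_mono s (fun x (hx : x ∈ Set.Iio s) => ne_of_lt hx))
  rw [add_zero] at hsum
  refine le_of_tendsto hsum ?_
  filter_upwards [self_mem_nhdsWithin] with x hx
  have hx' : x < s := hx
  rw [slope_def_field]
  refine div_nonpos_of_nonneg_of_nonpos ?_ (by linarith)
  have h1 := hle (s - x) (by linarith)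
  have h2 : ‖w s - (s - x) • w'‖ ≤ ‖w x‖ + ‖w x - w s - (x - s) • w'‖ := by
    refine le_of_eq_of_le (congrArg _ ?_) (norm_sub_le (w x) (w x - w s - (x - s) • w'))
    module
  simp only [Pi.add_apply, sub_self, zero_smul, norm_zero]
  linarith

theorem _root_.AbsolutelyContinuousOnInterval.le_of_ae_deriv_nonpos {φ : ℝ → ℝ} {a b : ℝ}
    (hab : a ≤ b) (hφ : AbsolutelyContinuousOnInterval φ a b)
    (hd : ∀ᵐ s, s ∈ Set.Ioo a b → deriv φ s ≤ 0) : φ b ≤ φ a := by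
  have h := hφ.integral_deriv_eq_sub
  have : ∫ s in a..b, deriv φ s ≤ 0 := by
    rw [intervalIntegral.integral_of_le hab, integral_Ioc_eq_integral_Ioo]
    exact setIntegral_nonpos_of_ae_restrict ((ae_restrict_iff' measurableSet_Ioo).2 hd)
  linarith

/-- In a separable space a separating set of functionals has a countable separating subset. -/
theorem SeparatesPoints.exists_countable [TopologicalSpace.SeparableSpace V]
    {Vstar : Set (V →L[ℝ] ℝ)} (h : SeparatesPoints Vstar) :
    ∃ C ⊆ Vstar, C.Countable ∧ SeparatesPoints C := by
  have : SecondCountableTopology V := UniformSpace.secondCountable_of_separable V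
  -- Lindelöf: countably many of the open sets where some functional is nonzero already cover their
  -- union.
  obtain ⟨C, hC, hCc, hU⟩ := TopologicalSpace.isOpen_biUnion_countable Vstar
    (fun Ψ : V →L[ℝ] ℝ => {v : V | Ψ v ≠ 0})
    (fun Ψ _ => isOpen_ne_fun Ψ.continuous continuous_const)
  refine ⟨C, hC, hCc, fun v hv => h v fun Ψ hΨ => ?_⟩
  by_contra hne
  have : v ∈ ⋃ Ψ ∈ Vstar, {v : V | Ψ v ≠ 0} := Set.mem_biUnion hΨ hne
  rw [← hU] at this
  obtain ⟨Φ, hΦ, hne'⟩ := Set.mem_iUnion₂.1 this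
  exact hne' (hv Φ hΦ)

end Curves

/-! ### Paths of strong solutions -/

section Paths

variable {V : Type*} [NormedAddCommGroup V] [NormedSpace ℝ V]
  {Z : Type*} [MeasurableSpace Z] {θ : PointFunction Z} {A : V → Set V} {A₀ : V → V}
  {Vstar : Set (V →L[ℝ] ℝ)} {x₀ : V} {ξ : PosTime × Z → V} {X : ℝ≥0 → V}

theorem IsWeakIntegralSolution.intervalIntegrable
    (hX : IsWeakIntegralSolution A₀ Vstar θ x₀ ξ X) {Ψ : V →L[ℝ] ℝ} (hΨ : Ψ ∈ Vstar)
    {t : ℝ≥0} (ht : 0 < t) :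
    IntervalIntegrable (fun τ : ℝ => Ψ (A₀ (X τ.toNNReal))) volume 0 t := by
  rw [intervalIntegrable_iff_integrableOn_Ioo_of_le t.coe_nonneg]
  exact hX.integrable t ht Ψ hΨ

variable [MeasurableSpace V] [BorelSpace V]

theorem IsWeakIntegralSolution.sum_identity (hX : IsWeakIntegralSolution A₀ Vstar θ x₀ ξ X)
    (hθ : θ.IsLocallyFinite) (hξ : Measurable ξ) {Ψ : V →L[ℝ] ℝ} (hΨ : Ψ ∈ Vstar)
    {t : ℝ≥0} (ht : 0 < t) :
    Ψ (X t) = Ψ x₀ - (∫ τ in (0 : ℝ)..t, Ψ (A₀ (X τ.toNNReal))) +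
      ∑ i ∈ hθ.points t, Ψ (ξ (i, θ.toFun i)) := by
  have h := hX.identity t ht Ψ hΨ
  rw [hθ.setIntegral_strip t (f := fun p => Ψ (ξ p)) (Ψ.continuous.measurable.comp hξ),
    map_sub] at h
  linarith

/-- Between the jumps, a path of a strong solution solves `X' = -A₀ X` almost everywhere. -/
theorem IsWeakIntegralSolution.ae_hasDerivAt [TopologicalSpace.SeparableSpace V]
    (hX : IsWeakIntegralSolution A₀ Vstar θ x₀ ξ X) (hV : SeparatesPoints Vstar)
    (hθ : θ.IsLocallyFinite) (hξ : Measurable ξ) {a b : ℝ≥0}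
    (hno : ∀ i : θ.domain, a ≤ i.1.1 → b < i.1.1)
    (hW : IsW11On (fun s : ℝ => X s.toNNReal) a b) :
    ∀ᵐ s : ℝ, s ∈ Set.Ioo (a : ℝ) b →
      HasDerivAt (fun s : ℝ => X s.toNNReal) (-A₀ (X s.toNNReal)) s := by
  rcases eq_or_ne b 0 with rfl | hb
  · refine Filter.Eventually.of_forall fun s hs => ?_
    exact absurd (hs.1.trans hs.2) (not_lt.2 a.2)
  obtain ⟨C, hC, hCc, hCs⟩ := hV.exists_countable
  -- Countability of `C` gives one exceptional null set for all functionals.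
  have hΨ : ∀ᵐ s : ℝ, ∀ Ψ ∈ C, s ∈ Set.uIcc 0 (b : ℝ) → ∀ c ∈ Set.uIcc 0 (b : ℝ),
      HasDerivAt (fun x => ∫ τ in c..x, Ψ (A₀ (X τ.toNNReal))) (Ψ (A₀ (X s.toNNReal))) s :=
    (ae_ball_iff hCc).2 fun Ψ h =>
      (hX.intervalIntegrable (hC h) (pos_iff_ne_zero.2 hb)).ae_hasDerivAt_integral
  filter_upwards [hΨ, (ae_restrict_iff' measurableSet_Icc).1 hW.2] with s hs hd hab
  have hder := (hd ⟨hab.1.le, hab.2.le⟩).hasDerivAt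
  have hs0 : 0 ≤ s := a.2.trans hab.1.le
  suffices h : deriv (fun s : ℝ => X s.toNNReal) s + A₀ (X s.toNNReal) = 0 by
    rwa [eq_neg_of_add_eq_zero_left h] at hder
  refine hCs _ fun Ψ h => ?_
  have h1 : HasDerivAt (fun s : ℝ => Ψ (X s.toNNReal)) _ s := Ψ.hasFDerivAt.comp_hasDerivAt s hder
  have h2 := hs Ψ h (by rw [Set.uIcc_of_le b.coe_nonneg]; exact ⟨hs0, hab.2.le⟩) 0 Set.left_mem_uIcc
  have h3 := (h2.const_sub (Ψ x₀)).add_const (∑ i ∈ hθ.points a, Ψ (ξ (i, θ.toFun i)))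
  -- Near `s` the jump sum is constant, so only the integral contributes to the derivative.
  have h4 : (fun s : ℝ => Ψ (X s.toNNReal)) =ᶠ[𝓝 s] fun x => (Ψ x₀ -
      ∫ τ in (0 : ℝ)..x, Ψ (A₀ (X τ.toNNReal))) + ∑ i ∈ hθ.points a, Ψ (ξ (i, θ.toFun i)) := by
    filter_upwards [Ioo_mem_nhds hab.1 hab.2] with x hx
    have hx0 : 0 < x := a.2.trans_lt hx.1
    have hax : a ≤ x.toNNReal := NNReal.le_toNNReal_of_coe_le hx.1.le
    have hxb : x.toNNReal ≤ b := Real.toNNReal_le_iff_le_coe.2 hx.2.le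
    have hp : hθ.points x.toNNReal = hθ.points a := by
      ext i
      rw [hθ.mem_points, hθ.mem_points]
      refine ⟨fun hi => ?_, fun hi => hi.trans hax⟩
      by_contra! h'
      exact absurd (hno i h'.le) (not_lt.2 (hi.trans hxb))
    rw [hX.sum_identity hθ hξ (hC h) (Real.toNNReal_pos.2 hx0), hp, Real.coe_toNNReal _ hx0.le]
  have h5 := h1.unique (h3.congr_of_eventuallyEq h4)
  rw [map_add, h5]
  ring

/-- The jump of a path of a strong solution at a point of the point process. -/
theorem IsWeakIntegralSolution.eq_add_of_tendsto
    (hX : IsWeakIntegralSolution A₀ Vstar θ x₀ ξ X) (hV : SeparatesPoints Vstar)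
    (hθ : θ.IsLocallyFinite) (hξ : Measurable ξ) (i : θ.domain) {l : V}
    (hl : Tendsto X (𝓝[<] i.1.1) (𝓝 l)) : X i.1.1 = l + ξ (i, θ.toFun i) := by
  classical
  have hi0 : (0 : ℝ≥0) < i.1.1 := i.1.2
  have : (𝓝[<] i.1.1).NeBot := nhdsLT_neBot_of_exists_lt ⟨0, hi0⟩
  rw [← sub_eq_zero]
  refine hV _ fun Ψ hΨ => ?_
  have hI := hX.intervalIntegrable hΨ hi0
  have hcont : Tendsto (fun s : ℝ≥0 => ∫ τ in (0 : ℝ)..s, Ψ (A₀ (X τ.toNNReal))) (𝓝[<] i.1.1)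
      (𝓝 (∫ τ in (0 : ℝ)..i.1.1, Ψ (A₀ (X τ.toNNReal)))) := by
    have h1 := intervalIntegral.continuousOn_primitive_interval' hI Set.left_mem_uIcc
      (i.1.1 : ℝ) Set.right_mem_uIcc
    refine Tendsto.comp h1 (tendsto_nhdsWithin_iff.2
      ⟨(NNReal.continuous_coe.tendsto _).mono_left nhdsWithin_le_nhds, ?_⟩)
    filter_upwards [self_mem_nhdsWithin] with s hs
    rw [Set.uIcc_of_le i.1.1.coe_nonneg]
    exact ⟨s.2, NNReal.coe_le_coe.2 (le_of_lt hs)⟩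
  have hlim : Tendsto (fun s : ℝ≥0 => Ψ (X s) + ∫ τ in (0 : ℝ)..s, Ψ (A₀ (X τ.toNNReal)))
      (𝓝[<] i.1.1) (𝓝 (Ψ l + ∫ τ in (0 : ℝ)..i.1.1, Ψ (A₀ (X τ.toNNReal)))) :=
    ((Ψ.continuous.tendsto l).comp hl).add hcont
  -- The integral is continuous in its endpoint, so the left limit misses only the summand at `i`.
  have hev : ∀ᶠ s : ℝ≥0 in 𝓝[<] i.1.1, Ψ (X s) + ∫ τ in (0 : ℝ)..s, Ψ (A₀ (X τ.toNNReal)) =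
      Ψ x₀ + ∑ j ∈ (hθ.points i.1.1).erase i, Ψ (ξ (j, θ.toFun j)) := by
    filter_upwards [hθ.eventually_left i.1.1, self_mem_nhdsWithin,
      mem_nhdsWithin_of_mem_nhds (Ioi_mem_nhds hi0)] with s hs hsi hs0
    rw [hX.sum_identity hθ hξ hΨ hs0, hθ.points_eq_erase hs hsi]
    ring
  have heq := tendsto_nhds_unique_of_eventuallyEq hlim tendsto_const_nhds hev
  have hXi := hX.sum_identity hθ hξ hΨ hi0
  rw [← Finset.add_sum_erase _ _ (hθ.mem_points.2 le_rfl : i ∈ hθ.points i.1.1)] at hXi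
  rw [map_sub, map_add]
  linarith

variable {y₀ : V} {ζ : PosTime × Z → V} {Y : ℝ≥0 → V}

/-- Between the jumps, the distance of two paths of strong solutions is nonincreasing. -/
theorem norm_sub_le_of_no_points_Icc [TopologicalSpace.SeparableSpace V] (hA : IsAccretive A)
    (hA₀ : ∀ v ∈ opDomain A, A₀ v ∈ A v) (hV : SeparatesPoints Vstar)
    (hθ : θ.IsLocallyFinite) (hξ : Measurable ξ) (hζ : Measurable ζ)
    (hXr : IsRegularPath A θ x₀ X) (hX : IsWeakIntegralSolution A₀ Vstar θ x₀ ξ X)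
    (hYr : IsRegularPath A θ y₀ Y) (hY : IsWeakIntegralSolution A₀ Vstar θ y₀ ζ Y)
    {a b : ℝ≥0} (ha : 0 < a) (hab : a ≤ b) (hno : ∀ i : θ.domain, a ≤ i.1.1 → b < i.1.1) :
    ‖X b - Y b‖ ≤ ‖X a - Y a‖ := by
  obtain ⟨m, hma, hmb⟩ := hθ.exists_hittingTime_between ha hno
  have hWX := hXr.regular m a b hab hma hmb
  have hWY := hYr.regular m a b hab hma hmb
  have hAC : AbsolutelyContinuousOnInterval
      (fun s : ℝ => ‖X s.toNNReal - Y s.toNNReal‖) a b := (hWX.1.sub hWY.1).norm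
  have hle := hAC.le_of_ae_deriv_nonpos (NNReal.coe_le_coe.2 hab) (by
    filter_upwards [hX.ae_hasDerivAt hV hθ hξ hno hWX, hY.ae_hasDerivAt hV hθ hζ hno hWY]
      with s hsX hsY hs
    have has : a ≤ s.toNNReal := NNReal.le_toNNReal_of_coe_le hs.1.le
    have hsb : s.toNNReal ≤ b := Real.toNNReal_le_iff_le_coe.2 hs.2.le
    have hs0 : 0 < s.toNNReal := ha.trans_le has
    have hne : ∀ i : θ.domain, i.1.1 ≠ s.toNNReal := fun i hi =>
      absurd (hno i (hi ▸ has)) (not_lt.2 (hi ▸ hsb))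
    refine deriv_norm_nonpos ((hsX hs).sub (hsY hs)) fun h hh => ?_
    refine (hA _ _ _ (hA₀ _ (hXr.mem_domain _ hs0 (hθ.ne_hittingTime hne))) _
      (hA₀ _ (hYr.mem_domain _ hs0 (hθ.ne_hittingTime hne))) h hh).trans_eq
      (congrArg _ ?_)
    module)
  simpa using hle

/-- Here `a` may be zero or a jump time, where absolute continuity is not available. The estimate on
`[s, b]` is used for `s > a`, and right continuity lets `s` decrease to `a`. -/
theorem norm_sub_le_of_no_points_Ioc [TopologicalSpace.SeparableSpace V] (hA : IsAccretive A)
    (hA₀ : ∀ v ∈ opDomain A, A₀ v ∈ A v) (hV : SeparatesPoints Vstar)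
    (hθ : θ.IsLocallyFinite) (hξ : Measurable ξ) (hζ : Measurable ζ)
    (hXr : IsRegularPath A θ x₀ X) (hX : IsWeakIntegralSolution A₀ Vstar θ x₀ ξ X)
    (hYr : IsRegularPath A θ y₀ Y) (hY : IsWeakIntegralSolution A₀ Vstar θ y₀ ζ Y)
    {a b : ℝ≥0} (hab : a ≤ b) (hno : ∀ i : θ.domain, a < i.1.1 → b < i.1.1) :
    ‖X b - Y b‖ ≤ ‖X a - Y a‖ := by
  rcases hab.eq_or_lt with rfl | hlt
  · rfl
  have hX' : Tendsto X (𝓝[>] a) (𝓝 (X a)) :=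
    (hXr.cadlag a).1.mono_left (nhdsWithin_mono a Set.Ioi_subset_Ici_self)
  have hY' : Tendsto Y (𝓝[>] a) (𝓝 (Y a)) :=
    (hYr.cadlag a).1.mono_left (nhdsWithin_mono a Set.Ioi_subset_Ici_self)
  have : (𝓝[>] a).NeBot := nhdsGT_neBot_of_exists_gt ⟨b, hlt⟩
  refine ge_of_tendsto (hX'.sub hY').norm ?_
  filter_upwards [self_mem_nhdsWithin, mem_nhdsWithin_of_mem_nhds (Iio_mem_nhds hlt)] with s hs hsb
  have has : a < s := hs
  exact norm_sub_le_of_no_points_Icc hA hA₀ hV hθ hξ hζ hXr hX hYr hY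
    (has.trans_le' a.2) (le_of_lt hsb) fun i hi => hno i (has.trans_le hi)

/-- The contraction estimate for paths of strong solutions. -/
theorem norm_sub_le_add_sum [TopologicalSpace.SeparableSpace V] (hA : IsAccretive A)
    (hA₀ : ∀ v ∈ opDomain A, A₀ v ∈ A v) (hV : SeparatesPoints Vstar)
    (hθ : θ.IsLocallyFinite) (hξ : Measurable ξ) (hζ : Measurable ζ)
    (hXr : IsRegularPath A θ x₀ X) (hX : IsWeakIntegralSolution A₀ Vstar θ x₀ ξ X)
    (hYr : IsRegularPath A θ y₀ Y) (hY : IsWeakIntegralSolution A₀ Vstar θ y₀ ζ Y) (t : ℝ≥0) :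
    ‖X t - Y t‖ ≤ ‖X 0 - Y 0‖ +
      ∑ i ∈ hθ.points t, ‖ξ (i, θ.toFun i) - ζ (i, θ.toFun i)‖ := by
  classical
  induction hn : (hθ.points t).card using Nat.strong_induction_on generalizing t with
  | _ n ih =>
    subst hn
    rcases (hθ.points t).eq_empty_or_nonempty with hempty | hne
    · rw [hempty, Finset.sum_empty, add_zero]
      refine norm_sub_le_of_no_points_Ioc hA hA₀ hV hθ hξ hζ hXr hX hYr hY zero_le fun i _ => ?_
      by_contra! hi
      simpa [hempty] using hθ.mem_points.2 hi
    -- With `i` the last point up to `t`, the distance does not grow on `[i, t]`; just left of `i`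
    -- there is one point fewer, so the induction hypothesis applies and passes to the left limits.
    obtain ⟨i, hit, hmax⟩ := Finset.exists_max_image _ (fun i : θ.domain => i.1.1) hne
    rw [hθ.mem_points] at hit
    have hno : ∀ j : θ.domain, i.1.1 < j.1.1 → t < j.1.1 := fun j hj => by
      by_contra! hjt
      exact absurd (hmax j (hθ.mem_points.2 hjt)) (not_le.2 hj)
    have hpts : hθ.points t = hθ.points i.1.1 := by
      ext j
      rw [hθ.mem_points, hθ.mem_points]
      exact ⟨fun hj => hmax j (hθ.mem_points.2 hj), fun hj => hj.trans hit⟩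
    have hmem : i ∈ hθ.points i.1.1 := hθ.mem_points.2 le_rfl
    have h1 := norm_sub_le_of_no_points_Ioc hA hA₀ hV hθ hξ hζ hXr hX hYr hY hit hno
    obtain ⟨l, hl⟩ := (hXr.cadlag i.1.1).2
    obtain ⟨k, hk⟩ := (hYr.cadlag i.1.1).2
    have : (𝓝[<] i.1.1).NeBot := nhdsLT_neBot_of_exists_lt ⟨0, i.1.2⟩
    have h2 : ‖l - k‖ ≤ ‖X 0 - Y 0‖ + ∑ j ∈ (hθ.points i.1.1).erase i,
        ‖ξ (j, θ.toFun j) - ζ (j, θ.toFun j)‖ := by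
      refine le_of_tendsto (hl.sub hk).norm ?_
      filter_upwards [hθ.eventually_left i.1.1, self_mem_nhdsWithin] with s hs hsi
      have hps := hθ.points_eq_erase hs hsi
      rw [← hps]
      refine ih _ ?_ s rfl
      rw [hps, hpts]
      exact Finset.card_erase_lt_of_mem hmem
    rw [hX.eq_add_of_tendsto hV hθ hξ i hl, hY.eq_add_of_tendsto hV hθ hζ i hk,
      add_sub_add_comm] at h1
    rw [hpts, ← Finset.add_sum_erase _ _ hmem]
    have h3 := norm_add_le (l - k) (ξ (i, θ.toFun i) - ζ (i, θ.toFun i))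
    linarith

end Paths

/-! ### Limits of strong solutions -/

section Limits

variable {V : Type*} [NormedAddCommGroup V]

theorem tendsto_of_tendsto_iSup_enorm_sub {f : ℕ → ℝ≥0 → V} {g : ℝ≥0 → V} {s t : ℝ≥0}
    (h : Tendsto (fun m => ⨆ τ ∈ Set.Iic t, ‖f m τ - g τ‖ₑ) atTop (𝓝 0)) (hs : s ≤ t) :
    Tendsto (fun m => f m s) atTop (𝓝 (g s)) := by
  rw [tendsto_iff_edist_tendsto_0]
  refine tendsto_of_tendsto_of_tendsto_of_le_of_le tendsto_const_nhds h (fun _ => zero_le)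
    fun m => ?_
  rw [edist_eq_enorm_sub]
  exact le_iSup₂ (f := fun τ (_ : τ ∈ Set.Iic t) => ‖f m τ - g τ‖ₑ) s hs

variable [MeasurableSpace V] [BorelSpace V] [SecondCountableTopology V]
  {Z : Type*} [MeasurableSpace Z] {θ : PointFunction Z}

/-- The integral is a finite sum of norms and dominates each of its terms. -/
theorem PointFunction.IsLocallyFinite.tendsto_of_tendsto_setIntegral (h : θ.IsLocallyFinite)
    {ξs : ℕ → PosTime × Z → V} {ξ : PosTime × Z → V} (hξs : ∀ m, Measurable (ξs m))
    (hξ : Measurable ξ) {t : ℝ≥0}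
    (hlim : Tendsto (fun m => ∫ p in strip Z t, ‖ξs m p - ξ p‖ ∂θ.countingMeasure) atTop (𝓝 0))
    {i : θ.domain} (hi : i ∈ h.points t) :
    Tendsto (fun m => ξs m (i, θ.toFun i)) atTop (𝓝 (ξ (i, θ.toFun i))) := by
  rw [tendsto_iff_norm_sub_tendsto_zero]
  refine squeeze_zero (fun _ => norm_nonneg _) (fun m => ?_) hlim
  rw [h.setIntegral_strip t (f := fun p => ‖ξs m p - ξ p‖) ((hξs m).sub hξ).norm]
  exact Finset.single_le_sum
    (f := fun j : θ.domain => ‖ξs m (j, θ.toFun j) - ξ (j, θ.toFun j)‖)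
    (fun _ _ => norm_nonneg _) hi

end Limits

end ACPRM

theorem mainTheorem2
    {Ω : Type*} [MeasurableSpace Ω] (P : Measure Ω) [IsProbabilityMeasure P] [P.IsComplete]
    {Z : Type*} [MeasurableSpace Z]
    {V : Type*} [NormedAddCommGroup V] [NormedSpace ℝ V] [CompleteSpace V]
    [TopologicalSpace.SeparableSpace V] [MeasurableSpace V] [BorelSpace V]
    (Θ : Ω → ACPRM.PointFunction Z) (hΘ : ACPRM.IsFinitePointProcess P Θ)
    (A : V → Set V) (hA : ACPRM.IsMAccretive A) (hA_dense : ACPRM.IsDenselyDefined A)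
    (hA_inv : ACPRM.IsDomainInvariant A)
    (A₀ : V → V) (hA₀ : ACPRM.IsInfinitesimalGenerator A A₀)
    (Vstar : Set (V →L[ℝ] ℝ)) (hVstar : ACPRM.SeparatesPoints Vstar)
    (η₁ η₂ : ACPRM.PosTime × Z × Ω → V) (hη₁ : Measurable η₁) (hη₂ : Measurable η₂)
    (x₁ x₂ : Ω → V) (hx₁ : Measurable x₁) (hx₂ : Measurable x₂)
    (X₁ X₂ : ℝ≥0 × Ω → V)
    (hX₁ : ACPRM.IsMildSolution P Θ A A₀ Vstar x₁ η₁ X₁)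
    (hX₂ : ACPRM.IsMildSolution P Θ A A₀ Vstar x₂ η₂ X₂) :
    ∀ᵐ ω ∂P, ∀ t : ℝ≥0,
      IntegrableOn (fun p : ACPRM.PosTime × Z => ‖η₁ (p.1, p.2, ω) - η₂ (p.1, p.2, ω)‖)
        (ACPRM.strip Z t) (Θ ω).countingMeasure ∧
      ‖X₁ (t, ω) - X₂ (t, ω)‖ ≤ ‖x₁ ω - x₂ ω‖ +
        ∫ p in ACPRM.strip Z t, ‖η₁ (p.1, p.2, ω) - η₂ (p.1, p.2, ω)‖
          ∂(Θ ω).countingMeasure := by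
  have : SecondCountableTopology V := UniformSpace.secondCountable_of_separable V
  obtain ⟨xs, ηs, Xs, -, hηs, hXs, hXlim, hηlim⟩ := hX₁.approx
  obtain ⟨ys, ζs, Ys, -, hζs, hYs, hYlim, hζlim⟩ := hX₂.approx
  have hsec : ∀ {f : ACPRM.PosTime × Z × Ω → V} (_ : Measurable f) (ω : Ω),
      Measurable fun p : ACPRM.PosTime × Z => f (p.1, p.2, ω) := fun hf ω =>
    hf.comp (measurable_fst.prodMk (measurable_snd.prodMk measurable_const))
  filter_upwards [hΘ.ae_isLocallyFinite, hX₁.regular, hX₂.regular, hXlim, hηlim, hYlim, hζlim,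
    ae_all_iff.2 fun m => (hXs m).regular, ae_all_iff.2 fun m => (hXs m).solves,
    ae_all_iff.2 fun m => (hYs m).regular, ae_all_iff.2 fun m => (hYs m).solves]
    with ω hθ hr₁ hr₂ hXl hηl hYl hζl hXr hXw hYr hYw t
  have hmeas : Measurable fun p : ACPRM.PosTime × Z =>
      ‖η₁ (p.1, p.2, ω) - η₂ (p.1, p.2, ω)‖ := ((hsec hη₁ ω).sub (hsec hη₂ ω)).norm
  refine ⟨hθ.integrableOn_strip t hmeas, ?_⟩
  -- Writing the initial data as path values lets their convergence follow from that of the paths at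
  -- time zero.
  rw [hθ.setIntegral_strip t hmeas, ← hr₁.initial, ← hr₂.initial]
  -- Convergence is given only for positive times, and `t` may be zero.
  have hpos : 0 < t + 1 := by positivity
  have hle : t ≤ t + 1 := by simp
  have hlim : ∀ s ≤ t + 1, Tendsto (fun m => ‖Xs m (s, ω) - Ys m (s, ω)‖) atTop
      (𝓝 ‖X₁ (s, ω) - X₂ (s, ω)‖) := fun s hs =>
    ((ACPRM.tendsto_of_tendsto_iSup_enorm_sub (f := fun m τ => Xs m (τ, ω))
      (g := fun τ => X₁ (τ, ω)) (hXl _ hpos) hs).sub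
      (ACPRM.tendsto_of_tendsto_iSup_enorm_sub (f := fun m τ => Ys m (τ, ω))
      (g := fun τ => X₂ (τ, ω)) (hYl _ hpos) hs)).norm
  refine le_of_tendsto_of_tendsto' (hlim t hle) ((hlim 0 zero_le).add
    (tendsto_finsetSum (hθ.points t) fun i hi => ?_)) fun m =>
    ACPRM.norm_sub_le_add_sum hA.accretive hA₀.mem hVstar hθ (hsec (hηs m) ω) (hsec (hζs m) ω)
      (hXr m) (hXw m) (hYr m) (hYw m) t
  have hi' : i ∈ hθ.points (t + 1) := hθ.mem_points.2 ((hθ.mem_points.1 hi).trans hle)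
  exact ((hθ.tendsto_of_tendsto_setIntegral (fun m => hsec (hηs m) ω) (hsec hη₁ ω)
    (hηl _ hpos) hi').sub (hθ.tendsto_of_tendsto_setIntegral (fun m => hsec (hζs m) ω)
    (hsec hη₂ ω) (hζl _ hpos) hi')).norm
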